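/- Let $M$ be a unital (complex) $C^*$-algebra. Let $\mathcal I_0\subset M$ be a two-sided ideal with a norm $\|\cdot\|_{\mathcal I}$ such that $\|XTZ\|_{\mathcal I}\le\|X\|\,\|T\|_{\mathcal I}\,\|Z\|$ for all $X,Z\in M$ and $T\in\mathcal I_0$, and let $\mathcal I$ be the completion of $\mathcal I_0$ in this norm. For $X,Y\in M$ let $L_X,R_Y\in\mathcal B(\mathcal I)$ be the bounded operators that extend $T\mapsto XT$ and $T\mapsto TY$. Let $F,G:\mathbb C\to\mathbb C$ be entire functions of order of growth at most $1$, where the order of $F$ is $\limsup_{r\to\infty}\frac{\ln\ln\max_{|z|\le r}|F(z)|}{\ln r}$, all of whose nonzero roots are purely imaginary. Assume that $F(0)=G(0)=1$ and that $F'(0)-G'(0)$ is purely imaginary (possibly zero). Let $\{iz_k\}$ be the roots of $F$ and $\{iw_j\}$ the roots of $G$, repeated according to multiplicity ($z_k,w_j\in\mathbb R\setminus\{0\}$). Suppose that there is an injective assignment $k\mapsto j(k)$ such that, for every $k$, $w_{j(k)}$ has the same sign as $z_k$ and $z_k/w_{j(k)}>1$. Then for all self-adjoint $X,Y\in M$ the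 operator $G(L_X+R_Y)$ is invertible in $\mathcal B(\mathcal I)$, and $$\left\|F(L_X+R_Y)\,G(L_X+R_Y)^{-1}\right\|_{\mathcal B(\mathcal I)}\le 1 .$$ Here $F(A)=\sum_{n\ge0}\frac{F^{(n)}(0)}{n!}A^n$ for $A\in\mathcal B(\mathcal I)$, and likewise for $G$. -/

import Mathlib

noncomputable section

/-! ### Normed ideals of a C*-algebra -/

/-- A two-sided ideal `I₀` of a unital C*-algebra `M`, equipped with a norm (`nrm`) such that
`‖X T Z‖_I ≤ ‖X‖ ‖T‖_I ‖Z‖` for all `X, Z ∈ M` and `T ∈ I₀`. -/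
structure NormedIdeal (M : Type*) [CStarAlgebra M] where
  /-- the underlying linear subspace of `M` -/
  carrier : Submodule ℂ M
  mul_mem_left : ∀ (X : M) {T : M}, T ∈ carrier → X * T ∈ carrier
  mul_mem_right : ∀ {T : M} (Z : M), T ∈ carrier → T * Z ∈ carrier
  /-- the norm of the ideal, unrelated in general to the norm of `M` -/
  nrm : Seminorm ℂ carrier
  eq_zero_of_nrm_eq_zero : ∀ T : carrier, nrm T = 0 → T = 0
  nrm_mul_mul_le : ∀ (X : M) (T : carrier) (Z : M),
    nrm ⟨X * T * Z, mul_mem_right Z (mul_mem_left X T.2)⟩ ≤ ‖X‖ * nrm T * ‖Z‖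

namespace NormedIdeal

variable {M : Type*} [CStarAlgebra M] (J : NormedIdeal M)

/-- The vector space `I₀`, as a type that carries the norm of the ideal instead of
the norm inherited from `M`. -/
def Pre : Type _ := J.carrier

instance : AddCommGroup J.Pre := inferInstanceAs (AddCommGroup J.carrier)

instance : Module ℂ J.Pre := inferInstanceAs (Module ℂ J.carrier)

instance : NormedAddCommGroup J.Pre :=
  AddGroupNorm.toNormedAddCommGroup
    { toFun := J.nrm
      map_zero' := map_zero J.nrm
      add_le' := map_add_le_add J.nrm
      neg' := map_neg_eq_map J.nrm
      eq_zero_of_map_eq_zero' := J.eq_zero_of_nrm_eq_zero }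

theorem norm_pre_def (T : J.Pre) : ‖T‖ = J.nrm T := rfl

instance : NormedSpace ℂ J.Pre where
  norm_smul_le c T := (map_smul_eq_mul J.nrm c T).le

/-- The Banach space `I`, the completion of `I₀` in the norm of the ideal. -/
abbrev Space : Type _ := UniformSpace.Completion J.Pre

/-- Left multiplication `T ↦ X T` on `I₀`. -/
def preLeft (X : M) : J.Pre →L[ℂ] J.Pre :=
  LinearMap.mkContinuous (σ := RingHom.id ℂ)
    { toFun := fun T => (⟨X * T.1, J.mul_mem_left X T.2⟩ : J.carrier)
      map_add' := fun S T => Subtype.ext (mul_add X S.1 T.1)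
      map_smul' := fun c T => Subtype.ext (mul_smul_comm c X T.1) }
    (‖X‖ * ‖(1 : M)‖) (fun T => by
      have h := J.nrm_mul_mul_le X T 1
      simp only [mul_one] at h
      calc _ ≤ _ := h
        _ = _ := by rw [norm_pre_def]; ring)

/-- Right multiplication `T ↦ T Y` on `I₀`. -/
def preRight (Y : M) : J.Pre →L[ℂ] J.Pre :=
  LinearMap.mkContinuous (σ := RingHom.id ℂ)
    { toFun := fun T => (⟨T.1 * Y, J.mul_mem_right Y T.2⟩ : J.carrier)
      map_add' := fun S T => Subtype.ext (add_mul S.1 T.1 Y)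
      map_smul' := fun c T => Subtype.ext (smul_mul_assoc c T.1 Y) }
    (‖(1 : M)‖ * ‖Y‖) (fun T => by
      have h := J.nrm_mul_mul_le 1 T Y
      simp only [one_mul] at h
      calc _ ≤ _ := h
        _ = _ := by rw [norm_pre_def]; ring)

/-- The operator `L_X` on `I`: the continuous extension of `T ↦ X T`. -/
def L (X : M) : J.Space →L[ℂ] J.Space := (J.preLeft X).completion

/-- The operator `R_Y` on `I`: the continuous extension of `T ↦ T Y`. -/
def R (Y : M) : J.Space →L[ℂ] J.Space := (J.preRight Y).completion

end NormedIdeal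

/-! ### Entire functions -/

/-- `M(r) = max {|F z| : |z| ≤ r}`. -/
def maxModulus (F : ℂ → ℂ) (r : ℝ) : ℝ :=
  sSup ((fun z : ℂ => ‖F z‖) '' Metric.closedBall 0 r)

/-- The order of growth `limsup_{r → ∞} log log M(r) / log r` of an entire function. -/
def growthOrder (F : ℂ → ℂ) : EReal :=
  Filter.limsup
    (fun r : ℝ => ((Real.log (Real.log (maxModulus F r)) / Real.log r : ℝ) : EReal))
    Filter.atTop

/-- Entire functions of order at most one all of whose nonzero roots are purely imaginary. -/
structure IsEntireWithImaginaryRoots (F : ℂ → ℂ) : Prop where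
  entire : Differentiable ℂ F
  order_le_one : growthOrder F ≤ 1
  roots_imaginary : ∀ z : ℂ, z ≠ 0 → F z = 0 → z.re = 0

/-- The roots of `F`, each one repeated according to its multiplicity: the elements are the
pairs of a root `z` and a natural number below the order of vanishing of `F` at `z`. -/
def RootsWithMult (F : ℂ → ℂ) : Type :=
  Σ z : {z : ℂ // F z = 0}, Fin (analyticOrderNatAt F z.1)

/-- The real number `t` when the given root is `i t`. -/
def RootsWithMult.height {F : ℂ → ℂ} (p : RootsWithMult F) : ℝ := p.1.1.im

/-- The value `F(a)` of an entire function `F` at an element `a` of a Banach algebra, given by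
the everywhere convergent power series of `F`. -/
def entireCalc {A : Type*} [NormedRing A] [NormedAlgebra ℂ A] (F : ℂ → ℂ) (a : A) : A :=
  ∑' n : ℕ, ((n.factorial : ℂ)⁻¹ * iteratedDeriv n F 0) • a ^ n

end

/-! The element a = L_X + R_Y is Hermitian: exp(ita) = L_U R_V with U = exp(itX), V = exp(itY)
unitary, so every exp(ita) is a contraction. Differentiating at t = 0 gives ‖T‖ ≤ ‖(1 - ca)T‖ for
imaginary c. For 0 ≤ r ≤ 1, convexity then gives ‖(1 - rca)T‖ ≤ ‖(1 - ca)T‖. So in a product of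
factors 1 - a/p with imaginary roots p, moving a root towards 0 along its ray, or adding a root, can
only increase norms.

This passes to entire functions through F(z) = ∏_{|p| ≤ N} (1 - z/p) · exp(c_N z) · E_N(z), where
E_N → 1 locally uniformly and Re c_N = Re F'(0) (`exists_factorization`). No Hadamard product is
needed, and the growth bound serves only to control E_N. The exponential factors for F and G differ
by exp of an imaginary multiple of a, which is a contraction. Letting N → ∞ gives ‖F(a)T‖ ≤ ‖G(a)T‖
for all T (`norm_entireCalc_mul_le`), and T = G(a)⁻¹ finishes. -/

open Filter Topology

/-! ### Power-series functional calculus for entire functions -/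

section EntireCalculus

variable {A : Type*} [NormedRing A] [NormedAlgebra ℂ A]

theorem norm_taylorCoeff_le {f : ℂ → ℂ} (hf : Differentiable ℂ f) {R C : ℝ} (hR : 0 < R)
    (hC : ∀ z ∈ Metric.sphere (0 : ℂ) R, ‖f z‖ ≤ C) (n : ℕ) :
    ‖(n.factorial : ℂ)⁻¹ * iteratedDeriv n f 0‖ ≤ C / R ^ n := by
  have h := Complex.norm_iteratedDeriv_le_of_forall_mem_sphere_norm_le n hR hf.diffContOnCl hC
  have hn : (0 : ℝ) < n.factorial := by exact_mod_cast n.factorial_pos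
  rw [norm_mul, norm_inv, Complex.norm_natCast, inv_mul_le_iff₀ hn]
  rwa [mul_div_assoc] at h

theorem summable_norm_pow_div {A : Type*} [NormedRing A] (a : A) {R : ℝ} (hR : ‖a‖ < R) :
    Summable fun n : ℕ => ‖a ^ n‖ / R ^ n := by
  have hR0 : 0 < R := (norm_nonneg a).trans_lt hR
  -- The term n = 0 is dropped because ‖1‖ is not assumed to be at most 1, so ‖a ^ n‖ ≤ ‖a‖ ^ n
  -- needs n > 0.
  refine (summable_nat_add_iff 1).1 ?_
  refine Summable.of_nonneg_of_le (fun n => by positivity) (fun n => ?_)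
    ((summable_nat_add_iff 1).2
      (summable_geometric_of_lt_one (r := ‖a‖ / R) (by positivity) ((div_lt_one hR0).2 hR)))
  rw [div_pow]
  gcongr
  exact norm_pow_le' a n.succ_pos

theorem norm_taylorTerm_le {f : ℂ → ℂ} (hf : Differentiable ℂ f) (a : A) {R C : ℝ} (hR : 0 < R)
    (hC : ∀ z ∈ Metric.sphere (0 : ℂ) R, ‖f z‖ ≤ C) (n : ℕ) :
    ‖((n.factorial : ℂ)⁻¹ * iteratedDeriv n f 0) • a ^ n‖ ≤ C * (‖a ^ n‖ / R ^ n) := by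
  rw [norm_smul]
  calc _ ≤ C / R ^ n * ‖a ^ n‖ := by gcongr; exact norm_taylorCoeff_le hf hR hC n
    _ = _ := by ring

theorem summable_norm_entireCalc {f : ℂ → ℂ} (hf : Differentiable ℂ f) (a : A) :
    Summable fun n : ℕ => ‖((n.factorial : ℂ)⁻¹ * iteratedDeriv n f 0) • a ^ n‖ := by
  have hR : ‖a‖ < ‖a‖ + 1 := lt_add_one _
  have hR0 : 0 < ‖a‖ + 1 := by positivity
  obtain ⟨C, hC⟩ := (isCompact_sphere (0 : ℂ) (‖a‖ + 1)).exists_bound_of_continuousOn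
    hf.continuous.continuousOn
  exact Summable.of_nonneg_of_le (fun n => norm_nonneg _) (norm_taylorTerm_le hf a hR0 hC)
    ((summable_norm_pow_div a hR).mul_left C)

/-- Cauchy's estimates bound the calculus by the supremum on one circle, with a factor depending
only on a and R; this makes it continuous for locally uniform convergence. -/
theorem norm_entireCalc_le {f : ℂ → ℂ} (hf : Differentiable ℂ f) (a : A) {R C : ℝ} (hR : ‖a‖ < R)
    (hC : ∀ z ∈ Metric.sphere (0 : ℂ) R, ‖f z‖ ≤ C) :
    ‖entireCalc f a‖ ≤ C * ∑' n : ℕ, ‖a ^ n‖ / R ^ n := by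
  have hs := (summable_norm_pow_div a hR).mul_left C
  rw [← tsum_mul_left]
  exact tsum_of_norm_bounded hs.hasSum
    (norm_taylorTerm_le hf a ((norm_nonneg a).trans_lt hR) hC)

theorem entireCalc_one_sub_mul (c : ℂ) (a : A) :
    entireCalc (fun z => 1 - c * z) a = 1 - c • a := by
  have hderiv : deriv (fun z : ℂ => 1 - c * z) = fun _ => -c := by
    funext z
    simp
  unfold entireCalc
  rw [tsum_eq_sum (s := Finset.range 2)]
  · simp [Finset.sum_range_succ, iteratedDeriv_one, sub_eq_add_neg]
  · intro n hn
    obtain ⟨m, rfl⟩ : ∃ m, n = m + 2 := ⟨n - 2, by simp at hn; omega⟩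
    rw [iteratedDeriv_succ', hderiv, iteratedDeriv_const]
    simp

theorem entireCalc_one (a : A) : entireCalc (1 : ℂ → ℂ) a = 1 := by
  have h : (1 : ℂ → ℂ) = fun z => 1 - 0 * z := by ext; simp
  rw [h, entireCalc_one_sub_mul, zero_smul, sub_zero]

theorem entireCalc_exp (c : ℂ) (a : A) :
    entireCalc (fun z => Complex.exp (c * z)) a = NormedSpace.exp (c • a) := by
  unfold entireCalc
  rw [NormedSpace.exp_eq_tsum ℂ]
  congr 1 with n
  simp [smul_pow, smul_smul, iteratedDeriv_cexp_const_mul]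

variable [CompleteSpace A]

theorem entireCalc_sub {f g : ℂ → ℂ} (hf : Differentiable ℂ f) (hg : Differentiable ℂ g) (a : A) :
    entireCalc (f - g) a = entireCalc f a - entireCalc g a := by
  unfold entireCalc
  rw [← (summable_norm_entireCalc hf a).of_norm.tsum_sub (summable_norm_entireCalc hg a).of_norm]
  congr 1 with n
  rw [iteratedDeriv_sub hf.contDiff.contDiffAt hg.contDiff.contDiffAt, mul_sub, sub_smul]

/-- The Cauchy product of the two absolutely convergent series matches the Leibniz rule coefficient
by coefficient. -/
theorem entireCalc_mul {f g : ℂ → ℂ} (hf : Differentiable ℂ f) (hg : Differentiable ℂ g) (a : A) :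
    entireCalc (f * g) a = entireCalc f a * entireCalc g a := by
  unfold entireCalc
  rw [tsum_mul_tsum_eq_tsum_sum_range_of_summable_norm (summable_norm_entireCalc hf a)
    (summable_norm_entireCalc hg a)]
  congr 1 with n
  rw [iteratedDeriv_mul hf.contDiff.contDiffAt hg.contDiff.contDiffAt, Finset.mul_sum,
    Finset.sum_smul]
  refine Finset.sum_congr rfl fun k hk => ?_
  have hkn : k ≤ n := Nat.lt_succ_iff.1 (Finset.mem_range.1 hk)
  rw [smul_mul_smul_comm, ← pow_add, Nat.add_sub_cancel' hkn, Nat.cast_choose ℂ hkn]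
  congr 1
  have h1 : (n.factorial : ℂ) ≠ 0 := by exact_mod_cast n.factorial_ne_zero
  have h2 : (k.factorial : ℂ) ≠ 0 := by exact_mod_cast k.factorial_ne_zero
  have h3 : ((n - k).factorial : ℂ) ≠ 0 := by exact_mod_cast (n - k).factorial_ne_zero
  field_simp

theorem tendsto_entireCalc_one {ι : Type*} {l : Filter ι} {E : ι → ℂ → ℂ}
    (hE : ∀ i, Differentiable ℂ (E i))
    (hlim : ∀ R, TendstoUniformlyOn E 1 l (Metric.closedBall 0 R)) (a : A) :
    Tendsto (fun i => entireCalc (E i) a) l (𝓝 1) := by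
  rw [Metric.tendsto_nhds]
  intro ε hε
  set K := ∑' n : ℕ, ‖a ^ n‖ / (‖a‖ + 1) ^ n
  have hK : 0 ≤ K := tsum_nonneg fun n => by positivity
  have hδ : 0 < ε / (K + 1) := by positivity
  filter_upwards [Metric.tendstoUniformlyOn_iff.1 (hlim (‖a‖ + 1)) _ hδ] with i hi
  rw [dist_eq_norm, ← entireCalc_one a,
    ← entireCalc_sub (g := 1) (hE i) (differentiable_const (1 : ℂ))]
  have h := norm_entireCalc_le ((hE i).sub (differentiable_const (1 : ℂ))) a (lt_add_one ‖a‖)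
    (C := ε / (K + 1)) fun z hz => by
      have := hi z (Metric.sphere_subset_closedBall hz)
      rw [dist_eq_norm, norm_sub_rev] at this
      exact this.le
  refine h.trans_lt ?_
  rw [div_mul_eq_mul_div, div_lt_iff₀ (by positivity)]
  change ε * K < ε * (K + 1)
  gcongr
  exact lt_add_one _

end EntireCalculus

/-! ### Norm inequalities and invertibility for Hermitian elements -/

section ContractiveExp

variable {A : Type*} [NormedRing A] [NormedAlgebra ℂ A]

/-- The one-parameter group `t ↦ exp (i t a)` consists of contractions, i.e. `a` is a Hermitian
element of the Banach algebra. -/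
def HasContractiveExp (a : A) : Prop :=
  ∀ t : ℝ, ‖NormedSpace.exp (((t : ℂ) * Complex.I) • a)‖ ≤ 1

namespace HasContractiveExp

variable {a : A}

theorem norm_exp_smul_le (ha : HasContractiveExp a) {c : ℂ} (hc : c.re = 0) :
    ‖NormedSpace.exp (c • a)‖ ≤ 1 := by
  have h : c = (c.im : ℂ) * Complex.I := by
    apply Complex.ext <;> simp [hc]
  rw [h]
  exact ha _

variable [CompleteSpace A]

theorem norm_le_norm_exp_mul (ha : HasContractiveExp a) {c : ℂ} (hc : c.re = 0) (T : A) :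
    ‖T‖ ≤ ‖NormedSpace.exp (c • a) * T‖ := by
  let +nondep : NormedAlgebra ℚ A := .restrictScalars ℚ ℂ A
  have hinv : NormedSpace.exp ((-c) • a) * NormedSpace.exp (c • a) = 1 := by
    rw [← NormedSpace.exp_add_of_commute (((Commute.refl a).smul_left _).smul_right _), neg_smul,
      neg_add_cancel, NormedSpace.exp_zero]
  calc ‖T‖ = ‖NormedSpace.exp ((-c) • a) * (NormedSpace.exp (c • a) * T)‖ := by
        rw [← mul_assoc, hinv, one_mul]
    _ ≤ ‖NormedSpace.exp ((-c) • a)‖ * ‖NormedSpace.exp (c • a) * T‖ := norm_mul_le _ _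
    _ ≤ 1 * ‖NormedSpace.exp (c • a) * T‖ := by
        gcongr
        exact ha.norm_exp_smul_le (by simp [hc])
    _ = _ := one_mul _

/-- Infinitesimal form of the previous bound: (1 - ca)T is the limit of T + h⁻¹(exp(-hca)T - T) as h
→ 0 from the right. -/
theorem norm_le_norm_one_sub_smul_mul (ha : HasContractiveExp a) {c : ℂ} (hc : c.re = 0) (T : A) :
    ‖T‖ ≤ ‖(1 - c • a) * T‖ := by
  have hd : HasDerivAt (fun h : ℝ => NormedSpace.exp (h • (-c • a)) * T) ((-c • a) * T) 0 := by
    have := (hasDerivAt_exp_smul_const (𝕂 := ℝ) (-c • a) (0 : ℝ)).mul_const T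
    rwa [zero_smul, NormedSpace.exp_zero, one_mul] at this
  have hlim := (hasDerivAt_iff_tendsto_slope_zero.1 hd).mono_left
    (nhdsWithin_mono (0 : ℝ) (fun x (hx : 0 < x) => hx.ne') : 𝓝[>] (0 : ℝ) ≤ 𝓝[≠] 0)
  have hlim' := (hlim.const_add T).norm
  have heq : T + (-c • a) * T = (1 - c • a) * T := by
    rw [sub_mul, one_mul, neg_smul, neg_mul, sub_eq_add_neg]
  rw [heq] at hlim'
  refine ge_of_tendsto hlim' ?_
  filter_upwards [Ioo_mem_nhdsGT (zero_lt_one (α := ℝ))] with h hh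
  have h0 : 0 < h := hh.1
  simp only [zero_add, zero_smul, NormedSpace.exp_zero, one_mul]
  set U := NormedSpace.exp (h • (-c • a)) * T with hU
  have hUT : ‖T‖ ≤ ‖U‖ := by
    have := ha.norm_le_norm_exp_mul (c := (h : ℂ) * -c) (by simp [hc]) T
    rwa [mul_smul, Complex.coe_smul] at this
  -- With h < 1 both coefficients are nonnegative, so ‖T‖ ≤ ‖U‖ and the reverse triangle inequality
  -- leave exactly ‖T‖.
  have hsplit : T + h⁻¹ • (U - T) = h⁻¹ • U - (h⁻¹ - 1) • T := by
    rw [smul_sub, sub_smul, one_smul]; abel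
  have h1 : 1 ≤ h⁻¹ := (one_le_inv₀ h0).2 hh.2.le
  rw [hsplit]
  calc ‖T‖ = h⁻¹ * ‖T‖ - (h⁻¹ - 1) * ‖T‖ := by ring
    _ ≤ h⁻¹ * ‖U‖ - (h⁻¹ - 1) * ‖T‖ := by gcongr
    _ = ‖h⁻¹ • U‖ - ‖(h⁻¹ - 1) • T‖ := by
        rw [norm_smul, norm_smul, Real.norm_of_nonneg (by positivity),
          Real.norm_of_nonneg (by linarith)]
    _ ≤ _ := norm_sub_norm_le _ _

/-- 1 - rca is the convex combination r(1 - ca) + (1 - r)1, and ‖T‖ is already dominated by ‖(1 -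
ca)T‖. -/
theorem norm_one_sub_smul_mul_le (ha : HasContractiveExp a) {c : ℂ} (hc : c.re = 0) {r : ℝ}
    (hr0 : 0 ≤ r) (hr1 : r ≤ 1) (T : A) :
    ‖(1 - ((r : ℂ) * c) • a) * T‖ ≤ ‖(1 - c • a) * T‖ := by
  have hsplit : (1 - ((r : ℂ) * c) • a) * T = r • ((1 - c • a) * T) + (1 - r) • T := by
    rw [mul_smul, Complex.coe_smul, sub_mul, sub_mul, smul_sub, sub_smul, smul_mul_assoc,
      one_smul, one_mul]
    abel
  calc _ ≤ ‖r • ((1 - c • a) * T)‖ + ‖(1 - r) • T‖ := by rw [hsplit]; exact norm_add_le _ _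
    _ = r * ‖(1 - c • a) * T‖ + (1 - r) * ‖T‖ := by
        rw [norm_smul, norm_smul, Real.norm_of_nonneg hr0, Real.norm_of_nonneg (by linarith)]
    _ ≤ r * ‖(1 - c • a) * T‖ + (1 - r) * ‖(1 - c • a) * T‖ := by
        gcongr
        exact ha.norm_le_norm_one_sub_smul_mul hc T
    _ = _ := by ring

/-- If z is in the spectrum of a, then exp(itz) is in that of exp(ita), so |exp(itz)| ≤ 1 for t of
both signs. Asking ‖1‖ ≤ 1 rather than ‖1‖ = 1 keeps the zero algebra, which occurs when the ideal
is zero. -/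
theorem im_eq_zero_of_mem_spectrum (ha : HasContractiveExp a) (h1 : ‖(1 : A)‖ ≤ 1) {z : ℂ}
    (hz : z ∈ spectrum ℂ a) : z.im = 0 := by
  have key : ∀ t : ℝ, -(t * z.im) ≤ 0 := by
    intro t
    rcases eq_or_ne t 0 with rfl | ht
    · simp
    have hu : (t : ℂ) * Complex.I ≠ 0 := by simp [ht]
    have hmem : ((t : ℂ) * Complex.I) • z ∈ spectrum ℂ (((t : ℂ) * Complex.I) • a) := by
      simpa only [Units.smul_def, Units.val_mk0] using
        spectrum.smul_mem_smul_iff (r := Units.mk0 _ hu).2 hz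
    have hexp := spectrum.norm_le_norm_mul_of_mem (spectrum.exp_mem_exp _ hmem)
    have hle : ‖NormedSpace.exp (((t : ℂ) * Complex.I) • z)‖ ≤ 1 :=
      hexp.trans (mul_le_one₀ (ha t) (norm_nonneg _) h1)
    rw [← Complex.exp_eq_exp_ℂ, Complex.norm_exp, Real.exp_le_one_iff] at hle
    simpa using hle
  have := key 1
  have := key (-1)
  linarith

theorem isUnit_one_sub_smul (ha : HasContractiveExp a) (h1 : ‖(1 : A)‖ ≤ 1) {c : ℂ}
    (hc : c.re = 0) : IsUnit (1 - c • a) := by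
  rcases eq_or_ne c 0 with rfl | hc0
  · simp
  have hmem : c⁻¹ ∉ spectrum ℂ a := by
    intro h
    have him := ha.im_eq_zero_of_mem_spectrum h1 h
    have hre : c⁻¹.re = 0 := by simp [Complex.inv_re, hc]
    exact inv_ne_zero hc0 (Complex.ext hre him)
  have hu := (spectrum.notMem_iff.1 hmem).smul (Units.mk0 c hc0)
  rw [Units.smul_def, Units.val_mk0, smul_sub, Algebra.algebraMap_eq_smul_one, smul_smul,
    mul_inv_cancel₀ hc0, one_smul] at hu
  exact hu

end HasContractiveExp

end ContractiveExp

/-! ### Multiplication operators on the ideal: L_X + R_Y is Hermitian -/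

namespace NormedIdeal

variable {M : Type*} [CStarAlgebra M] (J : NormedIdeal M)

theorem norm_one_le : ‖(1 : M)‖ ≤ 1 := by
  nontriviality M
  exact CStarRing.norm_one.le

theorem norm_completion_le {E : Type*} [NormedAddCommGroup E] [NormedSpace ℂ E] (f : E →L[ℂ] E) :
    ‖f.completion‖ ≤ ‖f‖ := by
  refine ContinuousLinearMap.opNorm_le_bound _ (norm_nonneg _) fun x => ?_
  induction x using UniformSpace.Completion.induction_on with
  | hp => exact isClosed_le (by fun_prop) (by fun_prop)
  | ih x =>
    rw [ContinuousLinearMap.completion_apply_coe, UniformSpace.Completion.norm_coe,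
      UniformSpace.Completion.norm_coe]
    exact f.le_opNorm x

theorem norm_L_le (X : M) : ‖J.L X‖ ≤ ‖X‖ := by
  refine (norm_completion_le _).trans ((LinearMap.mkContinuous_norm_le _ (by positivity) _).trans ?_)
  exact mul_le_of_le_one_right (norm_nonneg _) norm_one_le

theorem norm_R_le (Y : M) : ‖J.R Y‖ ≤ ‖Y‖ := by
  refine (norm_completion_le _).trans ((LinearMap.mkContinuous_norm_le _ (by positivity) _).trans ?_)
  exact mul_le_of_le_one_left (norm_nonneg _) norm_one_le

variable {J} in
theorem space_hom_ext {f g : J.Space →L[ℂ] J.Space}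
    (h : ∀ T : J.Pre, f (T : J.Space) = g (T : J.Space)) : f = g :=
  ContinuousLinearMap.ext fun x =>
    congrFun (UniformSpace.Completion.ext f.continuous g.continuous h) x

theorem L_coe (X : M) (T : J.Pre) : J.L X (T : J.Space) = (J.preLeft X T : J.Pre) :=
  ContinuousLinearMap.completion_apply_coe _ _

theorem R_coe (Y : M) (T : J.Pre) : J.R Y (T : J.Space) = (J.preRight Y T : J.Pre) :=
  ContinuousLinearMap.completion_apply_coe _ _

/-- `X ↦ L_X` as a ring homomorphism. -/
noncomputable def LHom : M →+* (J.Space →L[ℂ] J.Space) where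
  toFun := J.L
  map_one' := space_hom_ext fun T => by
    rw [L_coe]
    exact congrArg _ (Subtype.ext (one_mul _))
  map_mul' X Y := space_hom_ext fun T => by
    rw [mul_apply_eq_comp, L_coe, L_coe, L_coe]
    exact congrArg _ (Subtype.ext (mul_assoc _ _ _))
  map_zero' := space_hom_ext fun T => by
    rw [L_coe, _root_.zero_apply, ← UniformSpace.Completion.coe_zero]
    exact congrArg _ (Subtype.ext (zero_mul _))
  map_add' X Y := space_hom_ext fun T => by
    rw [_root_.add_apply, L_coe, L_coe, L_coe, ← UniformSpace.Completion.coe_add]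
    exact congrArg _ (Subtype.ext (add_mul _ _ _))

/-- `Y ↦ R_Y` as a ring homomorphism on the opposite algebra. -/
noncomputable def RHom : Mᵐᵒᵖ →+* (J.Space →L[ℂ] J.Space) where
  toFun Y := J.R Y.unop
  map_one' := space_hom_ext fun T => by
    rw [R_coe]
    exact congrArg _ (Subtype.ext (mul_one _))
  map_mul' X Y := space_hom_ext fun T => by
    rw [mul_apply_eq_comp, R_coe, R_coe, R_coe]
    exact congrArg _ (Subtype.ext (mul_assoc _ _ _).symm)
  map_zero' := space_hom_ext fun T => by
    rw [R_coe, _root_.zero_apply, ← UniformSpace.Completion.coe_zero]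
    exact congrArg _ (Subtype.ext (mul_zero _))
  map_add' X Y := space_hom_ext fun T => by
    rw [_root_.add_apply, R_coe, R_coe, R_coe, ← UniformSpace.Completion.coe_add]
    exact congrArg _ (Subtype.ext (mul_add _ _ _))

theorem L_smul (c : ℂ) (X : M) : J.L (c • X) = c • J.L X := space_hom_ext fun T => by
  rw [_root_.smul_apply, L_coe, L_coe, ← UniformSpace.Completion.coe_smul]
  exact congrArg _ (Subtype.ext (smul_mul_assoc _ _ _))

theorem R_smul (c : ℂ) (Y : M) : J.R (c • Y) = c • J.R Y := space_hom_ext fun T => by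
  rw [_root_.smul_apply, R_coe, R_coe, ← UniformSpace.Completion.coe_smul]
  exact congrArg _ (Subtype.ext (mul_smul_comm _ _ _))

theorem commute_L_R (X Y : M) : Commute (J.L X) (J.R Y) := space_hom_ext fun T => by
  rw [mul_apply_eq_comp, mul_apply_eq_comp, R_coe, L_coe, L_coe, R_coe]
  exact congrArg _ (Subtype.ext (mul_assoc _ _ _).symm)

theorem exp_L (X : M) : NormedSpace.exp (J.L X) = J.L (NormedSpace.exp X) := by
  let +nondep : NormedAlgebra ℚ M := .restrictScalars ℚ ℂ M
  let +nondep : NormedAlgebra ℚ (J.Space →L[ℂ] J.Space) := .restrictScalars ℚ ℂ _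
  refine (NormedSpace.map_exp J.LHom ?_ X).symm
  exact AddMonoidHomClass.continuous_of_bound J.LHom 1 fun X => by
    rw [one_mul]; exact J.norm_L_le X

theorem exp_R (Y : M) : NormedSpace.exp (J.R Y) = J.R (NormedSpace.exp Y) := by
  let +nondep : NormedAlgebra ℚ M := .restrictScalars ℚ ℂ M
  let +nondep : NormedAlgebra ℚ (J.Space →L[ℂ] J.Space) := .restrictScalars ℚ ℂ _
  have h := NormedSpace.map_exp J.RHom (AddMonoidHomClass.continuous_of_bound J.RHom 1 fun Y => by
    rw [one_mul]; exact J.norm_R_le Y.unop) (MulOpposite.op Y)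
  rw [NormedSpace.exp_op] at h
  exact h.symm

theorem norm_exp_le_one {X : M} (hX : IsSelfAdjoint X) (t : ℝ) :
    ‖NormedSpace.exp (((t : ℂ) * Complex.I) • X)‖ ≤ 1 := by
  have htX : t • X ∈ selfAdjoint M := (IsSelfAdjoint.all t).smul hX
  have h : ((t : ℂ) * Complex.I) • X = Complex.I • (t • X) := by
    rw [mul_comm, mul_smul, Complex.coe_smul]
  have hU := (selfAdjoint.expUnitary ⟨t • X, htX⟩).2
  rw [selfAdjoint.expUnitary_coe] at hU
  rw [h]
  nontriviality M
  exact (CStarRing.norm_of_mem_unitary hU).le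

theorem hasContractiveExp {X Y : M} (hX : IsSelfAdjoint X) (hY : IsSelfAdjoint Y) :
    HasContractiveExp (J.L X + J.R Y) := by
  intro t
  let +nondep : NormedAlgebra ℚ (J.Space →L[ℂ] J.Space) := .restrictScalars ℚ ℂ _
  rw [smul_add, ← L_smul, ← R_smul, NormedSpace.exp_add_of_commute (J.commute_L_R _ _), exp_L,
    exp_R]
  exact (norm_mul_le _ _).trans (mul_le_one₀ ((J.norm_L_le _).trans (norm_exp_le_one hX t))
    (norm_nonneg _) ((J.norm_R_le _).trans (norm_exp_le_one hY t)))

end NormedIdeal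

/-! ### Dividing out finitely many roots -/

section FiniteFactorization

theorem exists_eq_one_sub_pow_mul {p : ℂ} (hp : p ≠ 0) (n : ℕ) {f : ℂ → ℂ}
    (hf : Differentiable ℂ f) (hn : analyticOrderAt f p = n) :
    ∃ g : ℂ → ℂ, Differentiable ℂ g ∧ g p ≠ 0 ∧ ∀ z, f z = (1 - p⁻¹ * z) ^ n * g z := by
  induction n generalizing f with
  | zero =>
    refine ⟨f, hf, ?_, fun z => by simp⟩
    exact (hf.analyticAt p).analyticOrderAt_eq_zero.1 (by simpa using hn)
  | succ n ih =>
    have hfp : f p = 0 := apply_eq_zero_of_analyticOrderAt_ne_zero (by rw [hn]; simp)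
    have hslope : Differentiable ℂ (dslope f p) := by
      rw [← differentiableOn_univ] at hf ⊢
      exact (Complex.differentiableOn_dslope univ_mem).2 hf
    -- The factor -p turns z - p into the normalised 1 - z/p.
    set q : ℂ → ℂ := fun z => -p * dslope f p z with hq
    have hqd : Differentiable ℂ q := hslope.const_mul _
    have hfq : ∀ z, f z = (1 - p⁻¹ * z) * q z := fun z => by
      have h := sub_smul_dslope f p z
      rw [hfp, sub_zero, smul_eq_mul] at h
      rw [← h, hq]
      field_simp
      ring
    have hord : analyticOrderAt q p = n := by
      have hlin : analyticOrderAt (fun z : ℂ => 1 - p⁻¹ * z) p = 1 := by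
        refine AnalyticAt.analyticOrderAt_eq_one_of_zero_deriv_ne_zero (by fun_prop) ?_ ?_
        · simp [hp]
        · simp [hp]
      have hmul := analyticOrderAt_mul (z₀ := p) (f := fun z : ℂ => 1 - p⁻¹ * z) (g := q)
        (by fun_prop) (hqd.analyticAt p)
      rw [show (fun z : ℂ => 1 - p⁻¹ * z) * q = f from (funext hfq).symm, hn, hlin, Nat.add_comm,
        Nat.cast_add, Nat.cast_one] at hmul
      exact (ENat.add_right_injective_of_ne_top ENat.one_ne_top hmul).symm
    obtain ⟨g, hg, hgp, hqg⟩ := ih hqd hord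
    exact ⟨g, hg, hgp, fun z => by rw [hfq, hqg, pow_succ]; ring⟩

theorem exists_eq_prod_one_sub_pow_mul {F : ℂ → ℂ} (hF : Differentiable ℂ F) (hF0 : F 0 = 1)
    (S : Finset ℂ) (hS : ∀ p ∈ S, p ≠ 0) :
    ∃ g : ℂ → ℂ, Differentiable ℂ g ∧ (∀ p ∈ S, g p ≠ 0) ∧
      ∀ z, F z = (∏ p ∈ S, (1 - p⁻¹ * z) ^ analyticOrderNatAt F p) * g z := by
  classical
  induction S using Finset.induction_on with
  | empty => exact ⟨F, hF, by simp, by simp⟩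
  | insert q S hq ih =>
    obtain ⟨g, hg, hgS, hFg⟩ := ih fun p hp => hS p (Finset.mem_insert_of_mem hp)
    have hq0 : q ≠ 0 := hS q (Finset.mem_insert_self _ _)
    have htop : analyticOrderAt F q ≠ ⊤ := by
      rw [Ne, AnalyticOnNhd.analyticOrderAt_eq_top_iff_eq_zero q fun z => hF.analyticAt z]
      intro h
      simp [h] at hF0
    have hord : analyticOrderAt g q = analyticOrderNatAt F q := by
      set P : ℂ → ℂ := fun z => ∏ p ∈ S, (1 - p⁻¹ * z) ^ analyticOrderNatAt F p with hP
      have hPd : Differentiable ℂ P := by fun_prop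
      have hPq : analyticOrderAt P q = 0 := by
        rw [(hPd.analyticAt q).analyticOrderAt_eq_zero]
        refine Finset.prod_ne_zero_iff.2 fun p hp => pow_ne_zero _ ?_
        have hp0 : p ≠ 0 := hS p (Finset.mem_insert_of_mem hp)
        rw [sub_ne_zero]
        intro h
        rw [eq_inv_mul_iff_mul_eq₀ hp0, mul_one] at h
        exact hq (h ▸ hp)
      have hmul := analyticOrderAt_mul (hPd.analyticAt q) (hg.analyticAt q)
      rw [show P * g = F from (funext hFg).symm, hPq, zero_add] at hmul
      rw [Nat.cast_analyticOrderNatAt htop, hmul]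
    obtain ⟨k, hk, hkq, hgk⟩ := exists_eq_one_sub_pow_mul hq0 _ hg hord
    refine ⟨k, hk, ?_, fun z => ?_⟩
    · intro p hp
      rcases Finset.mem_insert.1 hp with rfl | hp
      · exact hkq
      · have := hgS p hp
        rw [hgk] at this
        exact right_ne_zero_of_mul this
    · rw [hFg, hgk, Finset.prod_insert hq]
      ring

theorem hasDerivAt_prod_one_sub_zero {ι : Type*} (s : Finset ι) (u : ι → ℂ) :
    HasDerivAt (fun z : ℂ => ∏ i ∈ s, (1 - u i * z)) (-∑ i ∈ s, u i) 0 := by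
  classical
  induction s using Finset.induction_on with
  | empty => simpa using hasDerivAt_const (0 : ℂ) (1 : ℂ)
  | insert j s hj ih =>
    simp only [Finset.prod_insert hj, Finset.sum_insert hj]
    have h := (((hasDerivAt_id (0 : ℂ)).const_mul (u j)).const_sub 1).mul ih
    refine h.congr_deriv ?_
    simp
    ring

theorem finite_roots_closedBall {F : ℂ → ℂ} (hF : Differentiable ℂ F) (hF0 : F 0 = 1) (r : ℝ) :
    {z : ℂ | F z = 0 ∧ ‖z‖ ≤ r}.Finite := by
  by_contra hinf
  obtain ⟨x, -, hx⟩ := Set.Infinite.exists_accPt_of_subset_isCompact hinf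
    (isCompact_closedBall (0 : ℂ) r) fun z hz => by simpa using hz.2
  have hfreq : ∃ᶠ z in 𝓝[≠] x, F z = 0 :=
    (accPt_iff_frequently_nhdsNE.1 hx).mono fun z hz => hz.1
  have hana : AnalyticOnNhd ℂ F Set.univ := fun z _ => hF.analyticAt z
  have := hana.eqOn_zero_of_preconnected_of_frequently_eq_zero
    isPreconnected_univ (Set.mem_univ x) hfreq (Set.mem_univ 0)
  simp [hF0] at this

end FiniteFactorization

/-! ### Growth bounds and logarithms of zero-free functions -/

section Growth

theorem norm_le_maxModulus {F : ℂ → ℂ} (hF : Continuous F) {r : ℝ} {z : ℂ} (hz : ‖z‖ ≤ r) :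
    ‖F z‖ ≤ maxModulus F r :=
  le_csSup ((isCompact_closedBall (0 : ℂ) r).image hF.norm).bddAbove
    ⟨z, by simpa using hz, rfl⟩

theorem eventually_norm_le_exp {F : ℂ → ℂ} (hF : Continuous F) (hord : growthOrder F ≤ 1) :
    ∀ᶠ r : ℝ in atTop, ∀ z : ℂ, ‖z‖ ≤ r → ‖F z‖ ≤ Real.exp (r ^ (3 / 2 : ℝ)) := by
  -- Any exponent strictly between 1 and 2 would serve; being below 2 is what later beats the N² in
  -- the Schwarz estimate.
  have hlt : growthOrder F < ((3 / 2 : ℝ) : EReal) :=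
    hord.trans_lt (by exact_mod_cast (by norm_num : (1 : ℝ) < 3 / 2))
  filter_upwards [eventually_lt_of_limsup_lt hlt, eventually_gt_atTop 1] with r hr hr1 z hz
  have hr0 : 0 < r := by linarith
  refine (norm_le_maxModulus hF hz).trans ?_
  set m := maxModulus F r
  have hm : 0 ≤ m := (norm_nonneg _).trans (norm_le_maxModulus hF hz)
  rw [EReal.coe_lt_coe_iff, div_lt_iff₀ (Real.log_pos hr1), ← Real.log_rpow hr0] at hr
  -- For log m ≤ 0 the iterated logarithm carries no usable information, but then m ≤ 1 anyway.
  rcases le_or_gt (Real.log m) 0 with hl | hl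
  · have : m ≤ 1 := by
      by_contra! h
      exact absurd (Real.log_pos h) hl.not_gt
    exact this.trans (Real.one_le_exp (by positivity))
  · have hm0 : 0 < m := hm.lt_of_ne' fun h => by simp [h] at hl
    rw [← Real.log_le_iff_le_exp hm0]
    exact ((Real.log_lt_log_iff hl (by positivity)).1 hr).le

/-- The logarithm is a primitive of f'/f on the disc, since f · exp(-g) has zero derivative. -/
theorem exists_exp_eq_of_ne_zero {f : ℂ → ℂ} {N : ℝ} (hN : 0 < N) (hf : Differentiable ℂ f)
    (hf0 : f 0 = 1) (hne : ∀ z ∈ Metric.ball (0 : ℂ) N, f z ≠ 0) :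
    ∃ g : ℂ → ℂ, DifferentiableOn ℂ g (Metric.ball 0 N) ∧ g 0 = 0 ∧ HasDerivAt g (deriv f 0) 0 ∧
      ∀ z ∈ Metric.ball (0 : ℂ) N, f z = Complex.exp (g z) := by
  have hd : DifferentiableOn ℂ (fun z => deriv f z / f z) (Metric.ball 0 N) :=
    hf.deriv.differentiableOn.div hf.differentiableOn hne
  obtain ⟨g, hg0, hg⟩ := hd.isExactOn_ball.with_val_at 0 0
  have h0 : (0 : ℂ) ∈ Metric.ball (0 : ℂ) N := Metric.mem_ball_self hN
  have hderiv : HasDerivAt g (deriv f 0) 0 := by simpa [hf0] using hg 0 h0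
  refine ⟨g, fun z hz => (hg z hz).differentiableAt.differentiableWithinAt, hg0, hderiv,
    fun z hz => ?_⟩
  have hquot : ∀ w ∈ Metric.ball (0 : ℂ) N,
      HasDerivAt (fun w => f w * Complex.exp (-g w)) 0 w := fun w hw => by
    refine ((hf w).hasDerivAt.mul (hg w hw).neg.cexp).congr_deriv ?_
    have := hne w hw
    field_simp
    ring
  have hconst := (convex_ball (0 : ℂ) N).is_const_of_fderivWithin_eq_zero (𝕜 := ℂ)
    (f := fun w => f w * Complex.exp (-g w))
    (fun w hw => (hquot w hw).differentiableAt.differentiableWithinAt)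
    (fun w hw => by
      rw [fderivWithin_of_isOpen Metric.isOpen_ball hw, (hquot w hw).hasFDerivAt.fderiv]
      ext
      simp) hz h0
  simp only [hf0, hg0, neg_zero, Complex.exp_zero, mul_one, Complex.exp_neg] at hconst
  rwa [mul_inv_eq_one₀ (Complex.exp_ne_zero _)] at hconst

/-- Borel–Carathéodory turns the bound Re log f ≤ B into |log f| ≤ 2B on the half disc. Removing the
linear term leaves a double zero at 0, and the second-order Schwarz lemma gives the decay |z|²/N².
-/
theorem norm_mul_exp_sub_one_le {f : ℂ → ℂ} {N B : ℝ} (hN : 0 < N) (hB : 0 < B)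
    (hf : Differentiable ℂ f) (hf0 : f 0 = 1) (hne : ∀ z ∈ Metric.ball (0 : ℂ) N, f z ≠ 0)
    (hbound : ∀ z ∈ Metric.ball (0 : ℂ) N, ‖f z‖ ≤ Real.exp B) {z : ℂ} (hz : ‖z‖ < N / 2)
    (hsmall : 16 * B * ‖z‖ ^ 2 / N ^ 2 ≤ 1) :
    ‖f z * Complex.exp (-(deriv f 0) * z) - 1‖ ≤ 32 * B * ‖z‖ ^ 2 / N ^ 2 := by
  obtain ⟨g, hg, hg0, hg', hfg⟩ := exists_exp_eq_of_ne_zero hN hf hf0 hne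
  have hN2 : 0 < N / 2 := by positivity
  have hsub : Metric.ball (0 : ℂ) (N / 2) ⊆ Metric.ball 0 N :=
    Metric.ball_subset_ball (by linarith)
  have hmaps : Set.MapsTo g (Metric.ball 0 N) {z | z.re ≤ B} := fun w hw => by
    have := hbound w hw
    rw [hfg w hw, Complex.norm_exp, Real.exp_le_exp] at this
    exact this
  have hgb : ∀ w ∈ Metric.ball (0 : ℂ) (N / 2), ‖g w‖ ≤ 2 * B := fun w hw => by
    have hw' : ‖w‖ < N / 2 := by simpa using hw
    refine (Complex.borelCaratheodory_zero hB hg hmaps hN (hsub hw) hg0).trans ?_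
    rw [div_le_iff₀ (by linarith)]
    nlinarith
  have hd : ‖deriv f 0‖ ≤ 2 * B / (N / 2) := by
    rw [← hg'.deriv]
    refine Complex.norm_deriv_le_div_of_mapsTo_ball (hg.mono hsub) (fun w hw => ?_) hN2
    simpa [hg0] using hgb w hw
  set h : ℂ → ℂ := fun w => g w - deriv f 0 * w with hh
  have hh0 : h 0 = 0 := by simp [hh, hg0]
  -- 2B from g and, by the Cauchy estimate for g'(0), another 2B from the linear term.
  have hhb : Set.MapsTo h (Metric.ball 0 (N / 2)) (Metric.closedBall (h 0) (4 * B)) := by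
    intro w hw
    have hw' : ‖w‖ < N / 2 := by simpa using hw
    rw [hh0, mem_closedBall_zero_iff]
    calc ‖h w‖ ≤ ‖g w‖ + ‖deriv f 0‖ * ‖w‖ := by
          rw [← norm_mul]; exact norm_sub_le _ _
      _ ≤ 2 * B + 2 * B / (N / 2) * (N / 2) := by gcongr; exact hgb w hw
      _ = 4 * B := by field_simp; ring
  have hho : (fun w => h w - h 0) =o[𝓝 0] fun w : ℂ => ‖w - 0‖ ^ 1 := by
    have := hasDerivAt_iff_isLittleO.1 hg'
    simp only [pow_one]
    refine Asymptotics.IsLittleO.norm_right ?_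
    refine this.congr_left fun w => ?_
    simp only [hh, hg0, smul_eq_mul, sub_zero, mul_zero]
    ring
  have hz' : z ∈ Metric.ball (0 : ℂ) (N / 2) := by simpa using hz
  have hhz : ‖h z‖ ≤ 16 * B * ‖z‖ ^ 2 / N ^ 2 := by
    have hdiff : DifferentiableOn ℂ h (Metric.ball 0 (N / 2)) :=
      (hg.mono hsub).sub ((differentiable_id.const_mul _).differentiableOn)
    have := Complex.dist_le_mul_div_pow_of_mapsTo_ball_of_isLittleO hdiff hhb hho hz'
    rw [hh0, dist_zero_right, dist_zero_right] at this
    refine this.trans_eq ?_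
    rw [div_div_eq_mul_div, div_pow]
    ring
  have hexp : f z * Complex.exp (-(deriv f 0) * z) = Complex.exp (h z) := by
    rw [hfg z (hsub hz'), ← Complex.exp_add, hh]
    congr 1
    ring
  rw [hexp]
  calc _ ≤ 2 * ‖h z‖ := Complex.norm_exp_sub_one_le (hhz.trans hsmall)
    _ ≤ 2 * (16 * B * ‖z‖ ^ 2 / N ^ 2) := by gcongr
    _ = _ := by ring

end Growth

/-! ### Factorization over roots counted with multiplicity -/

section RootFactorization

variable {F : ℂ → ℂ}

/-- The root itself, with its multiplicity index forgotten. -/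
def RootsWithMult.root (p : RootsWithMult F) : ℂ := p.1.1

theorem RootsWithMult.root_ne_zero (hF0 : F 0 = 1) (p : RootsWithMult F) : p.root ≠ 0 := by
  intro h
  have := p.1.2
  rw [show p.1.1 = 0 from h, hF0] at this
  exact one_ne_zero this

theorem IsEntireWithImaginaryRoots.root_eq (hF : IsEntireWithImaginaryRoots F) (hF0 : F 0 = 1)
    (p : RootsWithMult F) : p.root = (p.height : ℂ) * Complex.I := by
  have h := hF.roots_imaginary _ (p.root_ne_zero hF0) p.1.2
  apply Complex.ext
  · simpa using h
  · simp [RootsWithMult.root, RootsWithMult.height]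

theorem IsEntireWithImaginaryRoots.root_inv_re (hF : IsEntireWithImaginaryRoots F) (hF0 : F 0 = 1)
    (p : RootsWithMult F) : p.root⁻¹.re = 0 := by
  rw [hF.root_eq hF0]
  simp

theorem IsEntireWithImaginaryRoots.norm_root (hF : IsEntireWithImaginaryRoots F) (hF0 : F 0 = 1)
    (p : RootsWithMult F) : ‖p.root‖ = |p.height| := by
  rw [hF.root_eq hF0]
  simp

theorem IsEntireWithImaginaryRoots.height_ne_zero (hF : IsEntireWithImaginaryRoots F)
    (hF0 : F 0 = 1) (p : RootsWithMult F) : p.height ≠ 0 := by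
  rw [← abs_ne_zero, ← hF.norm_root hF0]
  exact norm_ne_zero_iff.2 (p.root_ne_zero hF0)

/-- Extraction of the roots of modulus at most `r`. -/
theorem exists_eq_prod_roots_mul (hF : Differentiable ℂ F) (hF0 : F 0 = 1) (r : ℝ) :
    ∃ (s : Finset (RootsWithMult F)) (g : ℂ → ℂ), (∀ p, p ∈ s ↔ ‖p.root‖ ≤ r) ∧
      Differentiable ℂ g ∧ (∀ z, ‖z‖ ≤ r → g z ≠ 0) ∧
      ∀ z, F z = (∏ p ∈ s, (1 - p.root⁻¹ * z)) * g z := by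
  have hfin := finite_roots_closedBall hF hF0 r
  have hfin' : {z : {z : ℂ // F z = 0} | ‖z.1‖ ≤ r}.Finite :=
    (hfin.preimage (f := Subtype.val) Subtype.val_injective.injOn).subset fun z hz => ⟨z.2, hz⟩
  set S := hfin'.toFinset with hS
  obtain ⟨g, hg, hgS, hFg⟩ := exists_eq_prod_one_sub_pow_mul hF hF0
    (S.map (Function.Embedding.subtype _)) (by
      intro p hp
      obtain ⟨q, -, rfl⟩ := Finset.mem_map.1 hp
      intro h
      have := q.2
      rw [show q.1 = 0 from h, hF0] at this
      exact one_ne_zero this)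
  refine ⟨S.sigma fun _ => Finset.univ, g, fun p => ?_, hg, fun z hz h0 => ?_, fun z => ?_⟩
  · refine Finset.mem_sigma.trans ?_
    simp [hS, RootsWithMult.root]
  · have hFz : F z = 0 := by rw [hFg, h0, mul_zero]
    refine hgS z (Finset.mem_map.2 ⟨⟨z, hFz⟩, ?_, rfl⟩) h0
    simpa [hS] using hz
  · rw [hFg, Finset.prod_map]
    congr 1
    refine Eq.trans ?_ (Finset.prod_sigma S (fun _ => Finset.univ)
      fun p : RootsWithMult F => 1 - p.root⁻¹ * z).symm
    refine Finset.prod_congr rfl fun q _ => ?_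
    simp [RootsWithMult.root]

theorem one_le_norm_one_sub_inv_mul {p z : ℂ} (hp : p ≠ 0) (h : 2 * ‖p‖ ≤ ‖z‖) :
    1 ≤ ‖1 - p⁻¹ * z‖ := by
  have hp' : 0 < ‖p‖ := norm_pos_iff.2 hp
  have h2 : 2 ≤ ‖p⁻¹ * z‖ := by
    rw [norm_mul, norm_inv, le_inv_mul_iff₀ hp']
    linarith
  have := norm_sub_norm_le (p⁻¹ * z) 1
  rw [norm_one, norm_sub_rev] at this
  linarith

/-- Let g_N be the cofactor of the roots of modulus at most N, and take c_N = g_N'(0). Then F'(0) =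
c_N - ∑ 1/p with an imaginary sum, which fixes Re c_N. The remainder is E_N(z) = g_N(z) exp(-c_N z).
-/
theorem IsEntireWithImaginaryRoots.exists_factorization (hF : IsEntireWithImaginaryRoots F)
    (hF0 : F 0 = 1) :
    ∃ (s : ℕ → Finset (RootsWithMult F)) (c : ℕ → ℂ) (E : ℕ → ℂ → ℂ),
      (∀ N p, p ∈ s N ↔ ‖p.root‖ ≤ N) ∧ (∀ N, (c N).re = (deriv F 0).re) ∧
      (∀ N, Differentiable ℂ (E N)) ∧
      (∀ N, F = (fun z => ∏ p ∈ s N, (1 - p.root⁻¹ * z)) *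
        ((fun z => Complex.exp (c N * z)) * E N)) ∧
      ∀ R, TendstoUniformlyOn E 1 atTop (Metric.closedBall 0 R) := by
  choose s g hs hg hgne hFg using fun N : ℕ => exists_eq_prod_roots_mul hF.entire hF0 N
  have hg0 : ∀ N, g N 0 = 1 := fun N => by
    have := hFg N 0
    simpa [hF0] using this.symm
  refine ⟨s, fun N => deriv (g N) 0, fun N z => g N z * Complex.exp (-(deriv (g N) 0) * z), hs,
    fun N => ?_, fun N => ?_, fun N => ?_, fun R => ?_⟩
  · have h := ((hasDerivAt_prod_one_sub_zero (s N) fun p => p.root⁻¹).mul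
      (hg N 0).hasDerivAt).deriv
    rw [show (fun z => ∏ p ∈ s N, (1 - p.root⁻¹ * z)) * g N = F from (funext (hFg N)).symm] at h
    rw [h]
    simp [hg0, hF.root_inv_re hF0]
  · have := hg N
    fun_prop
  · funext z
    simp only [Pi.mul_apply]
    rw [hFg N z, mul_left_comm (Complex.exp _), ← Complex.exp_add]
    simp
  · rw [Metric.tendstoUniformlyOn_iff]
    intro ε hε
    have hgrowth : ∀ᶠ N : ℕ in atTop, ∀ z : ℂ, ‖z‖ ≤ 2 * N →
        ‖F z‖ ≤ Real.exp ((2 * N : ℝ) ^ (3 / 2 : ℝ)) :=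
      (tendsto_natCast_atTop_atTop.const_mul_atTop (zero_lt_two (α := ℝ))).eventually
        (eventually_norm_le_exp hF.entire.continuous hF.order_le_one)
    have hlim : Tendsto (fun N : ℕ => 32 * (2 * N : ℝ) ^ (3 / 2 : ℝ) * R ^ 2 / (N : ℝ) ^ 2) atTop
        (𝓝 0) := by
      have h := ((tendsto_rpow_neg_atTop (y := 1 / 2) (by norm_num)).comp
        tendsto_natCast_atTop_atTop (α := ℕ)).const_mul (32 * 2 ^ (3 / 2 : ℝ) * R ^ 2)
      rw [mul_zero] at h
      refine h.congr' ?_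
      filter_upwards [eventually_gt_atTop 0] with N hN
      have hN : (0 : ℝ) < N := by exact_mod_cast hN
      have hpow : (N : ℝ) ^ (3 / 2 : ℝ) = (N : ℝ) ^ (-(1 / 2) : ℝ) * (N : ℝ) ^ 2 := by
        rw [← Real.rpow_natCast (N : ℝ) 2, ← Real.rpow_add hN]
        norm_num
      rw [Function.comp_apply, Real.mul_rpow zero_le_two hN.le, hpow]
      field_simp
    filter_upwards [hgrowth, hlim.eventually_lt_const hε,
      hlim.eventually_lt_const (zero_lt_two (α := ℝ)),
      tendsto_natCast_atTop_atTop.eventually_gt_atTop (2 * |R|), eventually_gt_atTop 0]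
      with N hN hNε hN2 hNR hN0 z hz
    have hN0 : (0 : ℝ) < N := by exact_mod_cast hN0
    have hzR : ‖z‖ ≤ R := by simpa using hz
    have hzR' : ‖z‖ ≤ |R| := hzR.trans (le_abs_self R)
    set B := (2 * N : ℝ) ^ (3 / 2 : ℝ) with hB
    have hB0 : 0 < B := by positivity
    -- Maximum principle on radius 2N: there every factor 1 - v/p with |p| ≤ N has modulus at least
    -- 1, so |g_N| ≤ |F|.
    have hgb : ∀ w ∈ Metric.ball (0 : ℂ) N, ‖g N w‖ ≤ Real.exp B := by
      intro w hw
      refine Complex.norm_le_of_forall_mem_frontier_norm_le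
        (U := Metric.ball (0 : ℂ) (2 * N)) Metric.isBounded_ball (hg N).diffContOnCl ?_
        (subset_closure (Metric.ball_subset_ball (by linarith) hw))
      intro v hv
      rw [frontier_ball (0 : ℂ) (by positivity), mem_sphere_zero_iff_norm] at hv
      have h1 : 1 ≤ ‖∏ p ∈ s N, (1 - p.root⁻¹ * v)‖ := by
        rw [norm_prod]
        refine Finset.prod_induction _ (fun x : ℝ => 1 ≤ x)
          (fun _ _ => one_le_mul_of_one_le_of_one_le) le_rfl fun p hp => ?_
        refine one_le_norm_one_sub_inv_mul (p.root_ne_zero hF0) ?_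
        rw [hv]
        have := (hs N p).1 hp
        gcongr
      calc ‖g N v‖ ≤ ‖∏ p ∈ s N, (1 - p.root⁻¹ * v)‖ * ‖g N v‖ :=
            le_mul_of_one_le_left (norm_nonneg _) h1
        _ = ‖F v‖ := by rw [hFg N v, norm_mul]
        _ ≤ Real.exp B := hN v hv.le
    have hmono : 32 * B * ‖z‖ ^ 2 / (N : ℝ) ^ 2 ≤ 32 * B * R ^ 2 / (N : ℝ) ^ 2 := by gcongr
    have key := norm_mul_exp_sub_one_le hN0 hB0 (hg N) (hg0 N)
      (fun w hw => hgne N w (by simpa using (Metric.ball_subset_closedBall hw))) hgb (z := z)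
      (by linarith) (by
        have : 16 * B * ‖z‖ ^ 2 / (N : ℝ) ^ 2 = (32 * B * ‖z‖ ^ 2 / (N : ℝ) ^ 2) / 2 := by ring
        rw [this]
        linarith)
    rw [Pi.one_apply, dist_eq_norm, norm_sub_rev]
    exact (key.trans hmono).trans_lt hNε

end RootFactorization

/-! ### Comparing F(a) with G(a) -/

section Comparison

variable {A : Type*} [NormedRing A] [NormedAlgebra ℂ A] [CompleteSpace A] {a : A}

theorem differentiable_prod_one_sub {ι : Type*} (s : Finset ι) (u : ι → ℂ) :
    Differentiable ℂ fun z : ℂ => ∏ i ∈ s, (1 - u i * z) := by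
  fun_prop

theorem entireCalc_prod_insert_mul {ι : Type*} [DecidableEq ι] {s : Finset ι} {i : ι} (hi : i ∉ s)
    (u : ι → ℂ) {f : ℂ → ℂ} (hf : Differentiable ℂ f) (a : A) :
    entireCalc ((fun z => ∏ j ∈ insert i s, (1 - u j * z)) * f) a =
      (1 - u i • a) * entireCalc ((fun z => ∏ j ∈ s, (1 - u j * z)) * f) a := by
  rw [← entireCalc_one_sub_mul, ← entireCalc_mul (by fun_prop)
    ((differentiable_prod_one_sub s u).mul hf)]
  congr 1
  funext z
  simp only [Pi.mul_apply, Finset.prod_insert hi]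
  ring

namespace HasContractiveExp

theorem norm_le_norm_prod_mul (ha : HasContractiveExp a) (T : A) {ι : Type*} (s : Finset ι)
    {u : ι → ℂ} (hu : ∀ i, (u i).re = 0) {f : ℂ → ℂ} (hf : Differentiable ℂ f) :
    ‖entireCalc f a * T‖ ≤ ‖entireCalc ((fun z => ∏ i ∈ s, (1 - u i * z)) * f) a * T‖ := by
  classical
  induction s using Finset.induction_on with
  | empty => simp only [Finset.prod_empty]; exact (congrArg (fun g => ‖entireCalc g a * T‖)
      (one_mul f).symm).le
  | insert i s hi ih =>
    rw [entireCalc_prod_insert_mul hi u hf, mul_assoc]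
    exact ih.trans (ha.norm_le_norm_one_sub_smul_mul (hu i) _)

theorem norm_prod_mul_le_of_subset (ha : HasContractiveExp a) (T : A) {ι : Type*} {s t : Finset ι}
    (hst : s ⊆ t) {u : ι → ℂ} (hu : ∀ i, (u i).re = 0) {f : ℂ → ℂ} (hf : Differentiable ℂ f) :
    ‖entireCalc ((fun z => ∏ i ∈ s, (1 - u i * z)) * f) a * T‖ ≤
      ‖entireCalc ((fun z => ∏ i ∈ t, (1 - u i * z)) * f) a * T‖ := by
  classical
  refine (ha.norm_le_norm_prod_mul T (t \ s) hu
    ((differentiable_prod_one_sub s u).mul hf)).trans_eq ?_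
  congr 3
  funext z
  simp only [Pi.mul_apply]
  rw [← mul_assoc, Finset.prod_sdiff hst]

theorem norm_prod_mul_le_of_ratio (ha : HasContractiveExp a) (T : A) {ι : Type*} (s : Finset ι)
    {u v : ι → ℂ} {r : ι → ℝ} (hr0 : ∀ i, 0 ≤ r i) (hr1 : ∀ i, r i ≤ 1)
    (huv : ∀ i, u i = r i * v i) (hv : ∀ i, (v i).re = 0) {f : ℂ → ℂ} (hf : Differentiable ℂ f) :
    ‖entireCalc ((fun z => ∏ i ∈ s, (1 - u i * z)) * f) a * T‖ ≤
      ‖entireCalc ((fun z => ∏ i ∈ s, (1 - v i * z)) * f) a * T‖ := by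
  classical
  induction s using Finset.induction_on generalizing f with
  | empty => simp
  | insert i s hi ih =>
    have hlin : Differentiable ℂ fun z : ℂ => 1 - u i * z := by fun_prop
    -- The factor for i is absorbed into f, so the induction hypothesis changes the other roots
    -- first; the root i is changed last.
    have hswap : ∀ w : ι → ℂ,
        entireCalc ((fun z => ∏ j ∈ s, (1 - w j * z)) * ((fun z => 1 - u i * z) * f)) a =
          (1 - u i • a) * entireCalc ((fun z => ∏ j ∈ s, (1 - w j * z)) * f) a := fun w => by
      rw [mul_left_comm, entireCalc_mul hlin ((differentiable_prod_one_sub s w).mul hf),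
        entireCalc_one_sub_mul]
    have h := ih (hlin.mul hf)
    rw [hswap, hswap] at h
    rw [entireCalc_prod_insert_mul hi u hf, entireCalc_prod_insert_mul hi v hf]
    refine h.trans ?_
    rw [mul_assoc, mul_assoc, huv i]
    exact ha.norm_one_sub_smul_mul_le (hv i) (hr0 i) (hr1 i) _

variable {F G : ℂ → ℂ}

theorem isUnit_entireCalc (ha : HasContractiveExp a) (h1 : ‖(1 : A)‖ ≤ 1)
    (hG : IsEntireWithImaginaryRoots G) (hG0 : G 0 = 1) : IsUnit (entireCalc G a) := by
  classical
  obtain ⟨s, c, E, -, -, hE, hGE, hlim⟩ := hG.exists_factorization hG0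
  -- Since E_N(a) → 1 and units form an open set, one large N suffices; the other factors are
  -- finitely many linear units and an exponential.
  obtain ⟨N, hN⟩ := ((tendsto_entireCalc_one hE hlim a).eventually
    (Units.isOpen.mem_nhds (isUnit_one : IsUnit (1 : A)))).exists
  have hexp : Differentiable ℂ fun z => Complex.exp (c N * z) := by fun_prop
  let +nondep : NormedAlgebra ℚ A := .restrictScalars ℚ ℂ A
  have hunit : IsUnit (entireCalc ((fun z => Complex.exp (c N * z)) * E N) a) := by
    rw [entireCalc_mul hexp (hE N), entireCalc_exp]
    exact (NormedSpace.isUnit_exp _).mul hN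
  rw [hGE N]
  induction s N using Finset.induction_on with
  | empty => simp only [Finset.prod_empty]; exact (congrArg (fun g => entireCalc g a)
      (one_mul ((fun z => Complex.exp (c N * z)) * E N))) ▸ hunit
  | insert p s hp ih =>
    rw [entireCalc_prod_insert_mul hp _ (hexp.mul (hE N))]
    exact (ha.isUnit_one_sub_smul h1 (hG.root_inv_re hG0 p)).mul ih

theorem norm_entireCalc_mul_le (ha : HasContractiveExp a)
    (hF : IsEntireWithImaginaryRoots F) (hG : IsEntireWithImaginaryRoots G)
    (hF0 : F 0 = 1) (hG0 : G 0 = 1) (hd : (deriv F 0 - deriv G 0).re = 0)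
    {φ : RootsWithMult F → RootsWithMult G} (hφ : Function.Injective φ)
    (hheight : ∀ p, 1 < p.height / (φ p).height) (T : A) :
    ‖entireCalc F a * T‖ ≤ ‖entireCalc G a * T‖ := by
  classical
  obtain ⟨s, c, E, hs, hc, hE, hFE, hElim⟩ := hF.exists_factorization hF0
  obtain ⟨t, d, D, ht, hdd, hD, hGD, hDlim⟩ := hG.exists_factorization hG0
  set r : RootsWithMult F → ℝ := fun p => (φ p).height / p.height with hr
  have hr_inv : ∀ p, r p = (p.height / (φ p).height)⁻¹ := fun p => (inv_div _ _).symm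
  have hr0 : ∀ p, 0 ≤ r p := fun p => by
    rw [hr_inv]; exact inv_nonneg.2 (zero_lt_one.trans (hheight p)).le
  have hr1 : ∀ p, r p ≤ 1 := fun p => by
    rw [hr_inv]; exact inv_le_one_of_one_le₀ (hheight p).le
  have hroot : ∀ p : RootsWithMult F, p.root⁻¹ = r p * (φ p).root⁻¹ := fun p => by
    have h1 : (p.height : ℂ) ≠ 0 := by exact_mod_cast hF.height_ne_zero hF0 p
    have h2 : ((φ p).height : ℂ) ≠ 0 := by exact_mod_cast hG.height_ne_zero hG0 (φ p)
    rw [hF.root_eq hF0, hG.root_eq hG0, hr]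
    push_cast
    field_simp
  -- Partners in G are closer to 0, so the same cutoff N captures them.
  have hsub : ∀ N, (s N).image φ ⊆ t N := fun N q hq => by
    obtain ⟨p, hp, rfl⟩ := Finset.mem_image.1 hq
    rw [ht]
    refine le_trans ?_ ((hs N p).1 hp)
    rw [hF.norm_root hF0, hG.norm_root hG0]
    have hpos : 0 < |(φ p).height| := abs_pos.2 (hG.height_ne_zero hG0 _)
    have := (hheight p).le.trans (le_abs_self _)
    rwa [abs_div, one_le_div hpos] at this
  -- Multiplying crosswise by the remainders D_N and E_N gives both sides the common cofactor `eF *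
  -- (E N * D N)`, up to the contraction `eQ` evaluated at a; only the finite products remain to be
  -- compared.
  have hstep : ∀ N, ‖entireCalc F a * entireCalc (D N) a * T‖ ≤
      ‖entireCalc G a * entireCalc (E N) a * T‖ := by
    intro N
    set eF : ℂ → ℂ := fun z => Complex.exp (c N * z) with heF
    set eG : ℂ → ℂ := fun z => Complex.exp (d N * z) with heG
    set eQ : ℂ → ℂ := fun z => Complex.exp ((c N - d N) * z) with heQ
    have heFd : Differentiable ℂ eF := by fun_prop
    have heQd : Differentiable ℂ eQ := by fun_prop
    have hf : Differentiable ℂ (eF * (E N * D N)) := heFd.mul ((hE N).mul (hD N))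
    have hFd : F * D N = (fun z => ∏ p ∈ s N, (1 - p.root⁻¹ * z)) * (eF * (E N * D N)) := by
      conv_lhs => rw [hFE N]
      ring
    have hGd : eQ * (G * E N) =
        (fun z => ∏ q ∈ t N, (1 - q.root⁻¹ * z)) * (eF * (E N * D N)) := by
      have hee : eQ * eG = eF := by
        funext z
        simp only [heQ, heG, heF, Pi.mul_apply, ← Complex.exp_add]
        congr 1
        ring
      rw [← hee]
      conv_lhs => rw [hGD N]
      ring
    rw [← entireCalc_mul hF.entire (hD N), ← entireCalc_mul hG.entire (hE N), hFd]
    refine (ha.norm_prod_mul_le_of_ratio T (s N) hr0 hr1 hroot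
      (fun p => hG.root_inv_re hG0 (φ p)) hf).trans ?_
    have himage : (fun z : ℂ => ∏ p ∈ s N, (1 - (φ p).root⁻¹ * z)) =
        fun z => ∏ q ∈ (s N).image φ, (1 - q.root⁻¹ * z) := by
      funext z
      rw [Finset.prod_image hφ.injOn]
    rw [himage]
    refine (ha.norm_prod_mul_le_of_subset T (hsub N) (hG.root_inv_re hG0) hf).trans ?_
    rw [← hGd, entireCalc_mul heQd (hG.entire.mul (hE N)), entireCalc_exp, mul_assoc]
    refine (norm_mul_le _ _).trans (mul_le_of_le_one_left (norm_nonneg _) ?_)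
    refine ha.norm_exp_smul_le ?_
    rw [Complex.sub_re, hc, hdd, ← Complex.sub_re, hd]
  have hl := (((tendsto_entireCalc_one hD hDlim a).const_mul (entireCalc F a)).mul_const T).norm
  have hr := (((tendsto_entireCalc_one hE hElim a).const_mul (entireCalc G a)).mul_const T).norm
  rw [mul_one] at hl hr
  exact le_of_tendsto_of_tendsto' hl hr hstep

end HasContractiveExp

end Comparison

theorem mainTheorem2 {M : Type*} [CStarAlgebra M] (J : NormedIdeal M)
    (F G : ℂ → ℂ) (hF : IsEntireWithImaginaryRoots F) (hG : IsEntireWithImaginaryRoots G)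
    (hF0 : F 0 = 1) (hG0 : G 0 = 1) (hd : (deriv F 0 - deriv G 0).re = 0)
    (hpair : ∃ φ : RootsWithMult F → RootsWithMult G, Function.Injective φ ∧
      ∀ p, (0 < p.height → 0 < (φ p).height) ∧ (p.height < 0 → (φ p).height < 0) ∧
        1 < p.height / (φ p).height)
    (X Y : M) (hX : IsSelfAdjoint X) (hY : IsSelfAdjoint Y) :
    IsUnit (entireCalc G (J.L X + J.R Y)) ∧
      ‖entireCalc F (J.L X + J.R Y) * Ring.inverse (entireCalc G (J.L X + J.R Y))‖ ≤ 1 := by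
  have ha := J.hasContractiveExp hX hY
  have h1 : ‖(1 : J.Space →L[ℂ] J.Space)‖ ≤ 1 := ContinuousLinearMap.norm_id_le
  have hu := ha.isUnit_entireCalc h1 hG hG0
  obtain ⟨φ, hφ, hheight⟩ := hpair
  refine ⟨hu, ?_⟩
  have h := ha.norm_entireCalc_mul_le hF hG hF0 hG0 hd hφ (fun p => (hheight p).2.2)
    (Ring.inverse (entireCalc G (J.L X + J.R Y)))
  rw [Ring.mul_inverse_cancel _ hu] at h
  exact h.trans h1
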